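/- Let $G$ be any group. Let $L(G)$ be the poset of all proper non-trivial subgroups of $G$, and let $\mathcal{C}(G)$ be the poset of all left cosets $gH$ ($g\in G$) of proper subgroups $H<G$, both ordered by inclusion. For a poset $P$ let $\Delta(P)$ be the simplicial complex whose simplices are the non-empty finite chains of $P$; topological notions for $P$ refer to the geometric realization $|\Delta(P)|$ (with the weak topology), and $H_1(P)$ is the first simplicial homology group of $\Delta(P)$ with coefficients in $\mathbb{Z}$. Let $n$ be the cardinality of the set of path-components of $L(G)$. If $n$ is finite, then $H_1(\mathcal{C}(G))$ has rank at least $n-1$; if $n$ is infinite, then $H_1(\mathcal{C}(G))$ has infinite rank. In particular, if $L(G)$ is disconnected (that is, it contains two points not joined by a path; the empty space is not disconnected), then $\mathcal{C}(G)$ is not simply connected. -/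

import Mathlib

/-- The order complex `Δ(P)` of a poset `P`: vertices are the elements of `P`, faces are the
nonempty finite chains of `P`. -/
def orderComplex (P : Type*) [PartialOrder P] : AbstractSimplicialComplex P where
  faces := {s | s.Nonempty ∧ IsChain (· ≤ ·) (s : Set P)}
  isRelLowerSet_faces := fun _ hs =>
    ⟨hs.1, fun _ hts ht => ⟨ht, hs.2.mono (Finset.coe_subset.mpr hts)⟩⟩
  singleton_mem := fun v => ⟨Finset.singleton_nonempty v, by simp⟩

/-- The points of the geometric realization `|K|` of an abstract simplicial complex `K`, in
barycentric coordinates: finitely supported functions `w : V → [0, ∞)` with total mass one whose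
support is a face of `K`. -/
structure GeometricRealization {V : Type*} (K : AbstractSimplicialComplex V) where
  weight : V →₀ ℝ
  nonneg : ∀ v, 0 ≤ weight v
  sum_eq_one : (weight.sum fun _ r => r) = 1
  support_mem : weight.support ∈ K.faces

namespace GeometricRealization

/-- The closed simplex of `|K|` spanned by a finite set `s` of vertices. -/
def closedSimplex {V : Type*} (K : AbstractSimplicialComplex V) (s : Finset V) :
    Set (GeometricRealization K) :=
  {x | x.weight.support ⊆ s}

/-- The usual (Euclidean) topology of a closed simplex, given by its barycentric coordinates. -/
abbrev simplexTopology {V : Type*} (K : AbstractSimplicialComplex V) (s : Finset V) :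
    TopologicalSpace (closedSimplex K s) :=
  TopologicalSpace.induced (fun x (v : V) => x.1.weight v)
    (inferInstance : TopologicalSpace (V → ℝ))

/-- The weak topology on `|K|`: a set is open if and only if its intersection with the closed
simplex spanned by each face of `K` is open in that simplex. -/
instance {V : Type*} (K : AbstractSimplicialComplex V) :
    TopologicalSpace (GeometricRealization K) :=
  ⨆ s : {s : Finset V // s ∈ K.faces},
    TopologicalSpace.coinduced (Subtype.val : closedSimplex K s.1 → GeometricRealization K)
      (simplexTopology K s.1)

end GeometricRealization

/-- The realization `|P| = |Δ(P)|` of a poset `P`. -/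
abbrev PosetRealization (P : Type*) [PartialOrder P] : Type _ :=
  GeometricRealization (orderComplex P)

namespace PosetHomology

/-- The `n`-simplices of `Δ(P)`, i.e. the chains `p₀ < p₁ < ⋯ < pₙ` of `P`, with the orientation
given by the order of `P`. -/
abbrev Simplex (P : Type*) [PartialOrder P] (n : ℕ) : Type _ := Fin (n + 1) ↪o P

/-- The face `p₀ < ⋯ < p̂ᵢ < ⋯ < pₙ₊₁` of the chain `p₀ < ⋯ < pₙ₊₁`. -/
def face {P : Type*} [PartialOrder P] {n : ℕ} (i : Fin (n + 2)) (σ : Simplex P (n + 1)) :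
    Simplex P n :=
  (Fin.succAboveOrderEmb i).trans σ

/-- The group of integral simplicial `n`-chains of `Δ(P)`. -/
abbrev Chains (P : Type*) [PartialOrder P] (n : ℕ) : Type _ := Simplex P n →₀ ℤ

/-- The simplicial boundary on `n`-chains, `∂σ = ∑ᵢ (-1)ⁱ (face i σ)` for `n ≥ 1`, and `∂ = 0` for
`n = 0` (where the target is irrelevant). -/
noncomputable def boundary (P : Type*) [PartialOrder P] :
    (n : ℕ) → Chains P n →ₗ[ℤ] Chains P (n - 1)
  | 0 => 0
  | n + 1 => Finsupp.linearCombination ℤ fun σ : Simplex P (n + 1) =>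
      ∑ i : Fin (n + 2), Finsupp.single (face i σ) ((-1 : ℤ) ^ (i : ℕ))

/-- The simplicial homology group `H_n(Δ(P); ℤ)`: cycles modulo boundaries. -/
abbrev Homology (P : Type*) [PartialOrder P] (n : ℕ) : Type _ :=
  LinearMap.ker (boundary P n) ⧸
    (LinearMap.range (boundary P (n + 1))).submoduleOf (LinearMap.ker (boundary P n))

end PosetHomology

/-- The subgroup poset `L(G)`: proper nontrivial subgroups of `G`, ordered by inclusion. -/
abbrev SubgroupPoset (G : Type*) [Group G] : Type _ := {H : Subgroup G // H ≠ ⊥ ∧ H ≠ ⊤}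

/-- The coset poset `C(G)`: left cosets `gH` of proper subgroups `H` of `G`, ordered by
inclusion. -/
abbrev CosetPoset (G : Type*) [Group G] : Type _ :=
  {S : Set G // ∃ (g : G) (H : Subgroup G), H ≠ ⊤ ∧ S = (fun h => g * h) '' (H : Set G)}

/-!
Write `m = {1}` for the trivial coset. It is a minimal element of the coset poset `C(G)`, and the
cosets lying strictly above it are exactly the proper nontrivial subgroups. So the link of the
vertex `m` in `Δ(C(G))` is `Δ(L(G))`, and the statement is about the piece
`H₁(C(G)) → H̃₀(L(G)) → H̃₀(C(G) ∖ {m})` of the Mayer-Vietoris sequence for the star and the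
deletion of `m`.

The map `H₁(C(G)) → H̃₀(L(G))` is written down on chains: an edge `m < q` goes to the component of
`q`, and every other edge goes to `0` (`PosetHomology.linkMap`, `PosetHomology.homologyLinkMap`). It
vanishes on boundaries because comparable elements of the link lie in the same component.

The map `H̃₀(L(G)) → H̃₀(C(G) ∖ {m})` is zero: for nontrivial `h ∈ H` and `k ∈ K` with `hk ≠ 1` the
zigzag `H ⊇ {h} ⊆ hK ⊇ {hk} ⊆ Hk ⊇ {k} ⊆ K` joins `H` to `K` without meeting `m`
(`CosetPoset.linkedAvoiding`). If `hk = 1` then `H` and `K` already lie in one component of `L(G)`.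
Closing the zigzag up through `m` gives a cycle whose image is the difference of the classes of `H`
and `K`, and these differences, for a fixed `K`, are linearly independent.

For the statement on simple connectivity, no Hurewicz theorem is needed. A component `A` of
the link defines a map from `|C(G)|` to the circle `ℝ / ℤ`, which is the barycentric coordinate
of `m` on the simplices joining `m` to `A`, and constant elsewhere
(`PosetRealization.toAddCircle`). Along the edge from `m` to an `H` in `A` it winds once around the
circle, whereas it is constant on the edge from `m` to a `K` not in `A` followed by the zigzag from
`K` to `H`. If these two paths were homotopic, their lifts to `ℝ` from a common starting point
would have a common endpoint.
-/

universe u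

/-! ### Paths in the geometric realization -/

namespace GeometricRealization

variable {V : Type*} {K : AbstractSimplicialComplex V}

@[ext]
theorem ext {x y : GeometricRealization K} (h : ∀ v, x.weight v = y.weight v) : x = y := by
  cases x; cases y
  congr
  exact Finsupp.ext h

theorem support_nonempty (x : GeometricRealization K) : x.weight.support.Nonempty := by
  rw [Finsupp.support_nonempty_iff]
  intro h
  simpa [h] using x.sum_eq_one

theorem sum_weight_eq_one {s : Finset V} {x : GeometricRealization K}
    (hx : x ∈ closedSimplex K s) : ∑ v ∈ s, x.weight v = 1 := by
  rw [← x.sum_eq_one, Finsupp.sum_of_support_subset _ hx _ (fun _ _ => rfl)]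

theorem weight_eq_zero_of_notMem {s : Finset V} {x : GeometricRealization K}
    (hx : x ∈ closedSimplex K s) {v : V} (hv : v ∉ s) : x.weight v = 0 := by
  by_contra h
  exact hv (hx (Finsupp.mem_support_iff.mpr h))

/-- A vertex of `K`, as a point of `|K|`. -/
noncomputable def vertex (K : AbstractSimplicialComplex V) (v : V) : GeometricRealization K where
  weight := Finsupp.single v 1
  nonneg w := by
    classical
    rw [Finsupp.single_apply]
    split_ifs <;> norm_num
  sum_eq_one := by simp
  support_mem := by
    rw [Finsupp.support_single _ one_ne_zero]
    exact K.singleton_mem v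

theorem vertex_mem_closedSimplex {s : Finset V} {v : V} (hv : v ∈ s) :
    vertex K v ∈ closedSimplex K s := by
  change (Finsupp.single v (1 : ℝ)).support ⊆ s
  rw [Finsupp.support_single _ one_ne_zero]
  simpa using hv

theorem continuous_subtypeVal {s : Finset V} (hs : s ∈ K.faces) :
    @Continuous _ _ (simplexTopology K s) _
      (Subtype.val : closedSimplex K s → GeometricRealization K) :=
  continuous_iff_coinduced_le.mpr
    (le_iSup (fun s : {s : Finset V // s ∈ K.faces} =>
      TopologicalSpace.coinduced (Subtype.val : closedSimplex K s.1 → GeometricRealization K)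
        (simplexTopology K s.1)) ⟨s, hs⟩)

/-- The universal property of the weak topology. -/
theorem continuous_of_forall_closedSimplex {Y : Type*} [TopologicalSpace Y]
    {f : GeometricRealization K → Y}
    (hf : ∀ s ∈ K.faces, @Continuous _ _ (simplexTopology K s) _
      (fun x : closedSimplex K s => f x)) : Continuous f := by
  rw [continuous_iSup_dom]
  rintro ⟨s, hs⟩
  rw [continuous_coinduced_dom]
  exact hf s hs

theorem continuous_weight {s : Finset V} (v : V) :
    @Continuous _ _ (simplexTopology K s) _ (fun x : closedSimplex K s => x.1.weight v) :=
  letI := simplexTopology K s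
  (continuous_apply v).comp continuous_induced_dom

/-- The point dividing the segment from `x` to `y` in the ratio `t : 1 - t`, for two points of a
common simplex. -/
noncomputable def lineMap {s : Finset V} (hs : s ∈ K.faces) {x y : GeometricRealization K}
    (hx : x ∈ closedSimplex K s) (hy : y ∈ closedSimplex K s) (t : unitInterval) :
    closedSimplex K s :=
  have hsub : ((1 - t.1) • x.weight + t.1 • y.weight).support ⊆ s := by
    intro v hv
    by_contra hvs
    simp [weight_eq_zero_of_notMem hx hvs, weight_eq_zero_of_notMem hy hvs] at hv
  have hsum : (((1 - t.1) • x.weight + t.1 • y.weight).sum fun _ r => r) = 1 := by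
    rw [Finsupp.sum_of_support_subset _ hsub _ (fun _ _ => rfl)]
    simp only [Finsupp.coe_add, Finsupp.coe_smul, Pi.add_apply, Pi.smul_apply, smul_eq_mul]
    rw [Finset.sum_add_distrib, ← Finset.mul_sum, ← Finset.mul_sum, sum_weight_eq_one hx,
      sum_weight_eq_one hy]
    ring
  ⟨{ weight := (1 - t.1) • x.weight + t.1 • y.weight
     nonneg := fun v => by
      have h1 := x.nonneg v
      have h2 := y.nonneg v
      have h3 : 0 ≤ 1 - t.1 := sub_nonneg.mpr t.2.2
      have h4 := t.2.1
      simp only [Finsupp.coe_add, Finsupp.coe_smul, Pi.add_apply, Pi.smul_apply, smul_eq_mul]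
      positivity
     sum_eq_one := hsum
     support_mem := (K.isRelLowerSet_faces hs).2 hsub (by
      show Finset.Nonempty _
      rw [Finsupp.support_nonempty_iff]
      intro h
      simp [h] at hsum) }, hsub⟩

theorem lineMap_weight {s : Finset V} (hs : s ∈ K.faces) {x y : GeometricRealization K}
    (hx : x ∈ closedSimplex K s) (hy : y ∈ closedSimplex K s) (t : unitInterval) (v : V) :
    (lineMap hs hx hy t).1.weight v = (1 - t.1) * x.weight v + t.1 * y.weight v := by
  simp [lineMap]

/-- The straight path between two points of a common simplex. -/
noncomputable def segmentPath {s : Finset V} (hs : s ∈ K.faces) {x y : GeometricRealization K}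
    (hx : x ∈ closedSimplex K s) (hy : y ∈ closedSimplex K s) : Path x y where
  toFun t := (lineMap hs hx hy t).1
  continuous_toFun := by
    let _ := simplexTopology K s
    refine (continuous_subtypeVal hs).comp (continuous_induced_rng.mpr ?_)
    refine continuous_pi fun v => ?_
    simp only [Function.comp_def, lineMap_weight]
    fun_prop
  source' := by
    ext v
    simp [lineMap_weight]
  target' := by
    ext v
    simp [lineMap_weight]

theorem segmentPath_mem {s : Finset V} (hs : s ∈ K.faces) {x y : GeometricRealization K}
    (hx : x ∈ closedSimplex K s) (hy : y ∈ closedSimplex K s) (t : unitInterval) :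
    segmentPath hs hx hy t ∈ closedSimplex K s :=
  (lineMap hs hx hy t).2

theorem joinedIn_closedSimplex {s : Finset V} (hs : s ∈ K.faces) {x y : GeometricRealization K}
    (hx : x ∈ closedSimplex K s) (hy : y ∈ closedSimplex K s) :
    JoinedIn (closedSimplex K s) x y :=
  ⟨segmentPath hs hx hy, segmentPath_mem hs hx hy⟩

theorem exists_joined_vertex (x : GeometricRealization K) : ∃ v, Joined (vertex K v) x := by
  obtain ⟨v, hv⟩ := x.support_nonempty
  exact ⟨v, (joinedIn_closedSimplex x.support_mem (vertex_mem_closedSimplex hv)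
    (Finset.Subset.refl _)).joined⟩

/-- The path component of a vertex. -/
noncomputable def component (K : AbstractSimplicialComplex V) (v : V) :
    ZerothHomotopy (GeometricRealization K) :=
  Quotient.mk (pathSetoid _) (vertex K v)

theorem component_eq_iff {v w : V} :
    component K v = component K w ↔ Joined (vertex K v) (vertex K w) :=
  Quotient.eq (r := pathSetoid _)

theorem component_surjective : Function.Surjective (component K) := by
  intro c
  obtain ⟨x, rfl⟩ := Quotient.exists_rep (s := pathSetoid _) c
  obtain ⟨v, hv⟩ := exists_joined_vertex x
  exact ⟨v, Quotient.sound (s := pathSetoid _) hv⟩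

end GeometricRealization

/-! ### Chains of a poset avoiding an element -/

theorem pair_mem_faces_orderComplex {P : Type*} [PartialOrder P] [DecidableEq P] {p q : P}
    (h : p ≤ q) : {p, q} ∈ (orderComplex P).faces := by
  refine ⟨Finset.insert_nonempty _ _, ?_⟩
  rw [Finset.coe_pair]
  exact IsChain.pair h

theorem component_eq_of_le {P : Type*} [PartialOrder P] {p q : P} (h : p ≤ q) :
    GeometricRealization.component (orderComplex P) p =
      GeometricRealization.component (orderComplex P) q := by
  classical
  exact GeometricRealization.component_eq_iff.mpr
    (GeometricRealization.joinedIn_closedSimplex (pair_mem_faces_orderComplex h)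
      (GeometricRealization.vertex_mem_closedSimplex (by simp))
      (GeometricRealization.vertex_mem_closedSimplex (by simp))).joined

/-- `p` and `q` are joined by a zigzag of comparable elements, all different from `m`. Of two
comparable elements only the lower one is required to differ from `m`, as this is meant for a
minimal `m`. -/
def LinkedAvoiding {P : Type*} [PartialOrder P] (m : P) : P → P → Prop :=
  Relation.EqvGen fun p q => p ≤ q ∧ p ≠ m

namespace LinkedAvoiding

variable {P : Type*} [PartialOrder P] {m p q r : P}

theorem of_le (h : p ≤ q) (hp : p ≠ m) : LinkedAvoiding m p q :=
  Relation.EqvGen.rel _ _ ⟨h, hp⟩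

theorem symm (h : LinkedAvoiding m p q) : LinkedAvoiding m q p :=
  Relation.EqvGen.symm _ _ h

theorem trans (h : LinkedAvoiding m p q) (h' : LinkedAvoiding m q r) : LinkedAvoiding m p r :=
  Relation.EqvGen.trans _ _ _ h h'

end LinkedAvoiding

/-! ### First homology and the components of the link of a minimal element -/

namespace PosetHomology

variable {P : Type*} [PartialOrder P]

/-- The `0`-simplex on an element. -/
def point (p : P) : Simplex P 0 :=
  OrderEmbedding.ofStrictMono (fun _ => p) (fun i j h => absurd h (by omega))

/-- The `1`-simplex on a strictly increasing pair. -/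
def edge {p q : P} (h : p < q) : Simplex P 1 :=
  OrderEmbedding.ofStrictMono ![p, q] (by
    rw [Fin.strictMono_iff_lt_succ]
    intro i
    fin_cases i
    simpa using h)

@[simp] theorem edge_zero {p q : P} (h : p < q) : edge h 0 = p := rfl

theorem eq_point (σ : Simplex P 0) : σ = point (σ 0) := by
  ext i
  rw [Fin.fin_one_eq_zero i]
  rfl

theorem boundary_single_edge {p q : P} (h : p < q) (a : ℤ) :
    boundary P 1 (Finsupp.single (edge h) a) =
      Finsupp.single (point q) a - Finsupp.single (point p) a := by
  have h0 : face 0 (edge h) = point q := eq_point _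
  have h1 : face 1 (edge h) = point p := eq_point _
  simp [boundary, Fin.sum_univ_two, h0, h1, sub_eq_add_neg]

variable {ι : Type*} {m : P} (c : Set.Ioi m → ι)

open Classical in
/-- The map on `1`-chains induced by a function `c` on the link `{q | m < q}` of a minimal element
`m`: an edge `m < q` goes to `c q`, and an edge not containing `m` goes to `0`. -/
noncomputable def linkMap : Chains P 1 →ₗ[ℤ] (ι →₀ ℤ) :=
  Finsupp.linearCombination ℤ fun σ : Simplex P 1 =>
    if h : σ 0 = m then
      Finsupp.single (c ⟨σ 1, h ▸ σ.strictMono Fin.zero_lt_one⟩) 1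
    else 0

theorem linkMap_single_of_eq {σ : Simplex P 1} (h : σ 0 = m) (a : ℤ) :
    linkMap c (Finsupp.single σ a) =
      Finsupp.single (c ⟨σ 1, h ▸ σ.strictMono Fin.zero_lt_one⟩) a := by
  simp [linkMap, h]

theorem linkMap_single_of_ne {σ : Simplex P 1} (h : σ 0 ≠ m) (a : ℤ) :
    linkMap c (Finsupp.single σ a) = 0 := by
  simp [linkMap, h]

/-- `linkMap` vanishes on boundaries: a triangle `m < q < r` goes to `c q - c r`, and a triangle
without `m` has no edge with `m`. -/
theorem linkMap_boundary (hm : IsMin m) (hc : ∀ p q, p ≤ q → c p = c q) (x : Chains P 2) :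
    linkMap c (boundary P 2 x) = 0 := by
  suffices h : linkMap c ∘ₗ boundary P 2 = 0 from LinearMap.congr_fun h x
  refine Finsupp.lhom_ext fun σ a => ?_
  have h0 : face 0 σ 0 = σ 1 := rfl
  have h1 : face 1 σ 0 = σ 0 := rfl
  have h2 : face 2 σ 0 = σ 0 := rfl
  have h01 : σ 0 < σ 1 := σ.strictMono (by decide)
  have hσ1 : face 0 σ 0 ≠ m := by
    rw [h0]
    rintro rfl
    exact hm.not_lt h01
  have key : boundary P 2 (Finsupp.single σ a) = Finsupp.single (face 0 σ) a
      - Finsupp.single (face 1 σ) a + Finsupp.single (face 2 σ) a := by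
    simp [boundary, Fin.sum_univ_three, smul_add, sub_eq_add_neg]
  rw [LinearMap.comp_apply, key, map_add, map_sub, linkMap_single_of_ne c hσ1]
  by_cases h : σ 0 = m
  · rw [linkMap_single_of_eq c (h1.trans h), linkMap_single_of_eq c (h2.trans h)]
    have hle : face 2 σ 1 ≤ face 1 σ 1 := σ.monotone (by decide)
    have hmem : face 1 σ 1 ∈ Set.Ioi m :=
      (h.symm.trans_lt h01).trans_le (σ.monotone (by decide))
    rw [hc ⟨face 2 σ 1, _⟩ ⟨face 1 σ 1, hmem⟩ hle]
    simp
  · rw [linkMap_single_of_ne c (h1 ▸ h), linkMap_single_of_ne c (h2 ▸ h)]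
    simp

/-- The connecting map from first homology to the free abelian group on the values of a function
`c` that is constant on the components of the link of `m`. -/
noncomputable def homologyLinkMap (hm : IsMin m) (hc : ∀ p q, p ≤ q → c p = c q) :
    Homology P 1 →ₗ[ℤ] (ι →₀ ℤ) :=
  Submodule.liftQ _ (linkMap c ∘ₗ (LinearMap.ker (boundary P 1)).subtype) (by
    rintro ⟨x, hx⟩ ⟨y, hy⟩
    simp only [LinearMap.mem_ker, LinearMap.comp_apply, ← hy]
    exact linkMap_boundary c hm hc y)

/-- A zigzag avoiding `m` carries a `1`-chain without edges at `m`. -/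
theorem _root_.LinkedAvoiding.exists_chain {p q : P} (h : LinkedAvoiding m p q) :
    ∃ w : Chains P 1, boundary P 1 w = Finsupp.single (point q) 1 - Finsupp.single (point p) 1 ∧
      linkMap c w = 0 := by
  induction h with
  | rel p q h =>
    obtain ⟨hle, hp⟩ := h
    rcases hle.eq_or_lt with rfl | hlt
    · exact ⟨0, by simp, by simp⟩
    · exact ⟨Finsupp.single (edge hlt) 1, boundary_single_edge hlt 1,
        linkMap_single_of_ne c (by simpa using hp) 1⟩
  | refl p => exact ⟨0, by simp, by simp⟩
  | symm p q _ ih =>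
    obtain ⟨w, h1, h2⟩ := ih
    exact ⟨-w, by rw [map_neg, h1, neg_sub], by rw [map_neg, h2, neg_zero]⟩
  | trans p q r _ _ ih ih' =>
    obtain ⟨w, h1, h2⟩ := ih
    obtain ⟨w', h1', h2'⟩ := ih'
    exact ⟨w + w', by rw [map_add, h1, h1']; abel, by rw [map_add, h2, h2', add_zero]⟩

/-- Closing a zigzag from `p` to `q` up through `m` gives a cycle with image `c p - c q`. -/
theorem exists_homologyLinkMap_eq (hm : IsMin m) (hc : ∀ p q, p ≤ q → c p = c q)
    (p q : Set.Ioi m) (h : LinkedAvoiding m p.1 q.1) :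
    ∃ z, homologyLinkMap c hm hc z = Finsupp.single (c p) 1 - Finsupp.single (c q) 1 := by
  obtain ⟨w, h1, h2⟩ := h.exists_chain c
  have hp : m < p.1 := p.2
  have hq : m < q.1 := q.2
  let x : Chains P 1 := Finsupp.single (edge hp) 1 + w - Finsupp.single (edge hq) 1
  have hx : x ∈ LinearMap.ker (boundary P 1) := by
    rw [LinearMap.mem_ker, map_sub, map_add, h1, boundary_single_edge, boundary_single_edge]
    abel
  refine ⟨Submodule.Quotient.mk ⟨x, hx⟩, ?_⟩
  change linkMap c x = _
  rw [map_sub, map_add, h2, linkMap_single_of_eq c (edge_zero hp),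
    linkMap_single_of_eq c (edge_zero hq), add_zero]
  rfl

/-- If distinct components of the link of `m` become connected in the complement of `m`, then the
rank of the first homology is at least the number of these components other than a given one. -/
theorem mk_ne_le_rank_homology {P ι : Type u} [PartialOrder P] {m : P} (c : Set.Ioi m → ι)
    (hm : IsMin m) (hc : ∀ p q, p ≤ q → c p = c q) (hsurj : Function.Surjective c)
    (hlink : ∀ p q, c p ≠ c q → LinkedAvoiding m p.1 q.1) (i₀ : ι) :
    Cardinal.mk {i // i ≠ i₀} ≤ Module.rank ℤ (Homology P 1) := by
  have hz : ∀ i : {i // i ≠ i₀}, ∃ z, homologyLinkMap c hm hc z =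
      Finsupp.single i.1 1 - Finsupp.single i₀ 1 := by
    rintro ⟨i, hi⟩
    obtain ⟨p, rfl⟩ := hsurj i
    obtain ⟨q, rfl⟩ := hsurj i₀
    exact exists_homologyLinkMap_eq c hm hc p q (hlink p q hi)
  choose z hz using hz
  -- Forgetting the coordinate `i₀` turns the images of the classes `z i` into a basis.
  have hli : LinearIndependent ℤ
      ((Finsupp.lsubtypeDomain {i | i ≠ i₀} ∘ₗ homologyLinkMap c hm hc) ∘ z) := by
    have heq : (Finsupp.lsubtypeDomain {i | i ≠ i₀} ∘ₗ homologyLinkMap c hm hc) ∘ z =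
        (Finsupp.basisSingleOne (R := ℤ) (ι := {i | i ≠ i₀})) := by
      funext i
      rw [Function.comp_apply, LinearMap.comp_apply, hz, Finsupp.coe_basisSingleOne]
      classical
      ext j
      have hj : i₀ ≠ j.1 := Ne.symm j.2
      change (Finsupp.single i.1 1 - Finsupp.single i₀ 1 : ι →₀ ℤ) j.1 = Finsupp.single i 1 j
      simp [Finsupp.single_apply, Subtype.ext_iff, hj]
    rw [heq]
    exact Module.Basis.linearIndependent _
  exact (LinearIndependent.of_comp _ hli).cardinal_le_rank

end PosetHomology

/-! ### A map to the circle -/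

namespace PosetRealization

open GeometricRealization

variable {P ι : Type*} [PartialOrder P] {m : P} (c : Set.Ioi m → ι) (i : ι)

open Classical in
/-- The map to `ℝ / ℤ` given by the barycentric coordinate of `m` at the points whose support
contains an element `q > m` with `c q = i`, and by `0` elsewhere. -/
noncomputable def toAddCircle (x : PosetRealization P) : AddCircle (1 : ℝ) :=
  if ∃ q : Set.Ioi m, q.1 ∈ x.weight.support ∧ c q = i then (x.weight m : AddCircle (1 : ℝ)) else 0

theorem toAddCircle_of_weight_eq_zero {x : PosetRealization P} (hx : x.weight m = 0) :
    toAddCircle c i x = 0 := by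
  simp [toAddCircle, hx]

theorem toAddCircle_of_forall_ne {s : Finset P} (hs : ∀ q : Set.Ioi m, q.1 ∈ s → c q ≠ i)
    {x : PosetRealization P} (hx : x ∈ closedSimplex (orderComplex P) s) :
    toAddCircle c i x = 0 :=
  if_neg fun ⟨q, hq, hi⟩ => hs q (hx hq) hi

theorem toAddCircle_of_forall_eq {s : Finset P}
    (hs : ∀ p ∈ s, p ≠ m → ∃ h : m < p, c ⟨p, h⟩ = i) {x : PosetRealization P}
    (hx : x ∈ closedSimplex (orderComplex P) s) :
    toAddCircle c i x = (x.weight m : AddCircle (1 : ℝ)) := by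
  by_cases h : ∃ p ∈ x.weight.support, p ≠ m
  · obtain ⟨p, hp, hpm⟩ := h
    obtain ⟨hlt, hi⟩ := hs p (hx hp) hpm
    exact if_pos ⟨⟨p, hlt⟩, hp, hi⟩
  · -- At the vertex `m` the coordinate is `1`, which is `0` in the circle.
    have hsub : x ∈ closedSimplex (orderComplex P) {m} := by
      intro p hp
      by_contra hpm
      exact h ⟨p, hp, by simpa using hpm⟩
    have h1 : x.weight m = 1 := by simpa using sum_weight_eq_one hsub
    have h0 : ((1 : ℝ) : AddCircle (1 : ℝ)) = 0 := AddCircle.coe_period 1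
    simp [toAddCircle, h1, h0]

theorem continuous_toAddCircle (hm : IsMin m) (hc : ∀ p q, p ≤ q → c p = c q) :
    Continuous (toAddCircle c i) := by
  refine continuous_of_forall_closedSimplex fun s hs => ?_
  let _ := simplexTopology (orderComplex P) s
  by_cases hms : m ∈ s
  · have hlt : ∀ p ∈ s, p ≠ m → m < p := fun p hp hpm =>
      (hs.2.total hms hp).elim (fun h => lt_of_le_of_ne h (Ne.symm hpm))
        fun h => lt_of_le_of_ne (hm h) (Ne.symm hpm)
    by_cases hq : ∃ q : Set.Ioi m, q.1 ∈ s ∧ c q = i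
    · obtain ⟨q, hqs, hqi⟩ := hq
      have hall : ∀ p ∈ s, p ≠ m → ∃ h : m < p, c ⟨p, h⟩ = i := by
        intro p hp hpm
        refine ⟨hlt p hp hpm, ?_⟩
        rw [← hqi]
        exact (hs.2.total hp hqs).elim (fun h => hc _ _ h) fun h => (hc _ _ h).symm
      have : (fun x : closedSimplex (orderComplex P) s => toAddCircle c i x.1) =
          fun x => ((x.1.weight m : ℝ) : AddCircle (1 : ℝ)) :=
        funext fun x => toAddCircle_of_forall_eq c i hall x.2
      rw [this]
      exact (AddCircle.continuous_mk' 1).comp (continuous_weight m)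
    · have : (fun x : closedSimplex (orderComplex P) s => toAddCircle c i x.1) = fun _ => 0 :=
        funext fun x => toAddCircle_of_forall_ne c i (fun q hqs hqi => hq ⟨q, hqs, hqi⟩) x.2
      rw [this]
      exact continuous_const
  · have : (fun x : closedSimplex (orderComplex P) s => toAddCircle c i x.1) = fun _ => 0 :=
      funext fun x => toAddCircle_of_weight_eq_zero c i (weight_eq_zero_of_notMem x.2 hms)
    rw [this]
    exact continuous_const

/-- A zigzag avoiding `m` is realized by a path on which `toAddCircle` vanishes. -/
theorem _root_.LinkedAvoiding.joinedIn (hm : IsMin m) {p q : P} (h : LinkedAvoiding m p q)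
    (hp : p ≠ m) :
    JoinedIn {x | toAddCircle c i x = 0} (vertex (orderComplex P) p)
      (vertex (orderComplex P) q) := by
  classical
  have hvert : ∀ {p : P}, p ≠ m → toAddCircle c i (vertex (orderComplex P) p) = 0 := fun hp =>
    toAddCircle_of_weight_eq_zero c i (Finsupp.single_eq_of_ne hp.symm)
  suffices H : (p = m ↔ q = m) ∧ (p ≠ m → JoinedIn {x | toAddCircle c i x = 0}
      (vertex (orderComplex P) p) (vertex (orderComplex P) q)) from H.2 hp
  clear hp
  induction h with
  | rel p q h =>
    obtain ⟨hle, hp⟩ := h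
    have hq : q ≠ m := by
      rintro rfl
      exact hp (hm.eq_of_le hle)
    refine ⟨iff_of_false hp hq, fun _ => ?_⟩
    refine (joinedIn_closedSimplex (pair_mem_faces_orderComplex hle)
      (vertex_mem_closedSimplex (by simp)) (vertex_mem_closedSimplex (by simp))).mono ?_
    exact fun x hx => toAddCircle_of_weight_eq_zero c i
      (weight_eq_zero_of_notMem hx (by simp [hp.symm, hq.symm]))
  | refl p => exact ⟨Iff.rfl, fun hp => JoinedIn.refl (hvert hp)⟩
  | symm p q _ ih => exact ⟨ih.1.symm, fun hq => (ih.2 fun hp => hq (ih.1.mp hp)).symm⟩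
  | trans p q r _ _ ih ih' =>
    exact ⟨ih.1.trans ih'.1, fun hp => (ih.2 hp).trans (ih'.2 fun hq => hp (ih.1.mpr hq))⟩

/-- If two components of the link of `m` become connected in the complement of `m`, then the
realization is not simply connected. -/
theorem not_simplyConnectedSpace (hm : IsMin m) (hc : ∀ p q, p ≤ q → c p = c q)
    (p q : Set.Ioi m) (hpq : c p ≠ c q) (hlink : LinkedAvoiding m p.1 q.1) :
    ¬ SimplyConnectedSpace (PosetRealization P) := by
  classical
  intro hsc
  have hp : m < p.1 := p.2
  have hq : m < q.1 := q.2
  have hfp := pair_mem_faces_orderComplex hp.le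
  have hfq := pair_mem_faces_orderComplex hq.le
  let f : C(PosetRealization P, AddCircle (1 : ℝ)) :=
    ⟨toAddCircle c (c p), continuous_toAddCircle c (c p) hm hc⟩
  have hvm : vertex (orderComplex P) m ∈ closedSimplex (orderComplex P) {m, p.1} :=
    vertex_mem_closedSimplex (by simp)
  have hvp : vertex (orderComplex P) p.1 ∈ closedSimplex (orderComplex P) {m, p.1} :=
    vertex_mem_closedSimplex (by simp)
  -- The direct path from `m` to `p`, on which `f` winds once.
  let γ : Path (vertex (orderComplex P) m) (vertex (orderComplex P) p.1) :=
    segmentPath hfp hvm hvp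
  -- The detour over `q`, on which `f` is constant.
  have hdetour : JoinedIn {x | toAddCircle c (c p) x = 0} (vertex (orderComplex P) m)
      (vertex (orderComplex P) p.1) := by
    refine JoinedIn.trans ?_ (hlink.joinedIn c (c p) hm hp.ne').symm
    refine (joinedIn_closedSimplex hfq (vertex_mem_closedSimplex (by simp))
      (vertex_mem_closedSimplex (by simp))).mono ?_
    refine fun x hx => toAddCircle_of_forall_ne c (c p) (fun r hr => ?_) hx
    have hrq : r = q := by
      rcases Finset.mem_insert.mp hr with h | h
      · exact absurd h (ne_of_gt r.2)
      · exact Subtype.ext (Finset.mem_singleton.mp h)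
    rw [hrq]
    exact hpq.symm
  obtain ⟨γ', hγ'⟩ := hdetour
  have hhom : (γ.map f.continuous).Homotopic (γ'.map f.continuous) :=
    (SimplyConnectedSpace.paths_homotopic γ γ').map f
  -- The lifts of the images of the two paths to the line, starting at `1`.
  let Γ : C(unitInterval, ℝ) := ⟨fun t => 1 - t.1, by fun_prop⟩
  let Γ' : C(unitInterval, ℝ) := .const _ 1
  have cov := AddCircle.isCoveringMap_coe (1 : ℝ)
  have hΓ : ContinuousMap.comp ⟨_, cov.continuous⟩ Γ = (γ.map f.continuous).toContinuousMap := by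
    ext t
    have hγt : (γ t).weight m = 1 - t.1 := by
      change (lineMap hfp hvm hvp t).1.weight m = _
      rw [lineMap_weight]
      simp [vertex, hp.ne]
    change ((1 - t.1 : ℝ) : AddCircle (1 : ℝ)) = toAddCircle c (c p) (γ t)
    rw [toAddCircle_of_forall_eq c (c p) (s := {m, p.1}) ?_ (segmentPath_mem hfp hvm hvp t), hγt]
    intro r hr hrm
    obtain rfl : r = p.1 := by simpa [hrm] using hr
    exact ⟨hp, rfl⟩
  have hΓ' : ContinuousMap.comp ⟨_, cov.continuous⟩ Γ' = (γ'.map f.continuous).toContinuousMap := by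
    ext t
    exact (AddCircle.coe_period (1 : ℝ)).trans (hγ' t).symm
  have hlift : Γ.HomotopicRel Γ' {0, 1} := by
    rw [cov.homotopicRel_iff_comp ⟨0, by simp, by simp [Γ, Γ']⟩, hΓ, hΓ']
    exact hhom
  have h1 : Γ 1 = Γ' 1 := by
    obtain ⟨H⟩ := hlift
    exact (H.eq_fst 0 (by simp)).symm.trans (H.eq_snd 0 (by simp))
  simp [Γ, Γ'] at h1

end PosetRealization

/-! ### The coset poset -/

namespace CosetPoset

variable {G : Type*} [Group G]

/-- The left coset `gH` of a proper subgroup `H`. -/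
def leftCoset (g : G) (H : Subgroup G) (hH : H ≠ ⊤) : CosetPoset G :=
  ⟨(fun h => g * h) '' (H : Set G), g, H, hH, rfl⟩

theorem mem_leftCoset {g x : G} {H : Subgroup G} {hH : H ≠ ⊤} :
    x ∈ (leftCoset g H hH).1 ↔ g⁻¹ * x ∈ H := by
  constructor
  · rintro ⟨h, hh, rfl⟩
    simpa using hh
  · exact fun h => ⟨g⁻¹ * x, h, by simp⟩

theorem mem_leftCoset_one {x : G} {H : Subgroup G} {hH : H ≠ ⊤} :
    x ∈ (leftCoset 1 H hH).1 ↔ x ∈ H := by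
  simp [mem_leftCoset]

/-- A right coset `Hk` is the left coset `k (k⁻¹ H k)`. -/
theorem exists_rightCoset (H : Subgroup G) (hH : H ≠ ⊤) (k : G) :
    ∃ S : CosetPoset G, ∀ x, x ∈ S.1 ↔ x * k⁻¹ ∈ H := by
  have hconj : H.map (MulAut.conj k⁻¹).toMonoidHom ≠ ⊤ := by
    intro h
    apply hH
    rw [eq_top_iff]
    intro x _
    have hx : (MulAut.conj k⁻¹) x ∈ H.map (MulAut.conj k⁻¹).toMonoidHom := h ▸ Subgroup.mem_top _
    obtain ⟨y, hy, hyx⟩ := hx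
    rwa [← (MulAut.conj k⁻¹).injective hyx]
  refine ⟨leftCoset k _ hconj, fun x => ?_⟩
  rw [mem_leftCoset]
  constructor
  · rintro ⟨y, hy, hyx⟩
    have hyx : k⁻¹ * y * k = k⁻¹ * x := by simpa using hyx
    have : x * k⁻¹ = y := by
      rw [mul_assoc] at hyx
      rw [← mul_left_cancel hyx]
      simp
    rwa [this]
  · exact fun h => ⟨x * k⁻¹, h, by simp [mul_assoc]⟩

theorem leftCoset_one_le_iff {H K : Subgroup G} {hH : H ≠ ⊤} {hK : K ≠ ⊤} :
    leftCoset 1 H hH ≤ leftCoset 1 K hK ↔ H ≤ K :=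
  ⟨fun h _ hx => mem_leftCoset_one.mp (h (mem_leftCoset_one.mpr hx)),
    fun h _ hx => mem_leftCoset_one.mpr (h (mem_leftCoset_one.mp hx))⟩

/-- Subgroups with a common nontrivial element lie in one component of `L(G)`, that of their
intersection. -/
theorem component_eq_of_mem {H K : SubgroupPoset G} {g : G} (hg : g ≠ 1) (hH : g ∈ H.1)
    (hK : g ∈ K.1) :
    GeometricRealization.component (orderComplex (SubgroupPoset G)) H =
      GeometricRealization.component (orderComplex (SubgroupPoset G)) K := by
  have hbot : H.1 ⊓ K.1 ≠ ⊥ := fun h =>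
    hg (Subgroup.mem_bot.mp (h ▸ Subgroup.mem_inf.mpr ⟨hH, hK⟩))
  have htop : H.1 ⊓ K.1 ≠ ⊤ := fun h => H.2.2 (top_le_iff.mp (h.ge.trans inf_le_left))
  let L : SubgroupPoset G := ⟨H.1 ⊓ K.1, hbot, htop⟩
  have hLH : L ≤ H := inf_le_left (a := H.1) (b := K.1)
  have hLK : L ≤ K := inf_le_right (a := H.1) (b := K.1)
  exact (_root_.component_eq_of_le hLH).symm.trans (_root_.component_eq_of_le hLK)

theorem nontrivial_of_component (i : ZerothHomotopy (PosetRealization (SubgroupPoset G))) :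
    Nontrivial G := by
  obtain ⟨H, -⟩ := GeometricRealization.component_surjective i
  obtain ⟨a, -, ha⟩ := (Subgroup.bot_or_exists_ne_one H.1).resolve_left H.2.1
  exact ⟨a, 1, ha⟩

variable [Nontrivial G]

/-- The singleton `{g}`, the coset of the trivial subgroup. -/
def singleton (g : G) : CosetPoset G := leftCoset g ⊥ bot_ne_top

theorem mem_singleton {g x : G} : x ∈ (singleton g).1 ↔ x = g := by
  rw [singleton, mem_leftCoset, Subgroup.mem_bot, inv_mul_eq_one, eq_comm]

theorem singleton_le_iff {g : G} {S : CosetPoset G} : singleton g ≤ S ↔ g ∈ S.1 :=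
  ⟨fun h => h (mem_singleton.mpr rfl), fun h _ hx => mem_singleton.mp hx ▸ h⟩

theorem singleton_ne_one {g : G} (hg : g ≠ 1) : singleton g ≠ singleton (1 : G) := fun h =>
  hg (mem_singleton.mp (h ▸ mem_singleton.mpr rfl : g ∈ (singleton (1 : G)).1))

theorem isMin_singleton (g : G) : IsMin (singleton g) := by
  rintro ⟨_, a, H, hH, rfl⟩ hle
  have ha : a = g := mem_singleton.mp (hle ⟨1, H.one_mem, mul_one a⟩)
  rw [singleton_le_iff]
  exact ⟨1, H.one_mem, by rw [ha]; exact mul_one g⟩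

/-- The cosets lying above `{1}` are the proper nontrivial subgroups. -/
theorem exists_eq_leftCoset_one (S : Set.Ioi (singleton (1 : G))) :
    ∃ H : SubgroupPoset G, S.1 = leftCoset 1 H.1 H.2.2 := by
  obtain ⟨⟨_, a, H, hH, rfl⟩, hlt⟩ := S
  have ha : a ∈ H := by
    obtain ⟨h, hh, h1⟩ := singleton_le_iff.mp (le_of_lt hlt)
    rw [eq_inv_of_mul_eq_one_left h1]
    exact H.inv_mem hh
  have heq : leftCoset a H hH = leftCoset 1 H hH := by
    refine Subtype.ext (Set.ext fun x => ?_)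
    rw [mem_leftCoset, mem_leftCoset_one, H.mul_mem_cancel_left (H.inv_mem ha)]
  refine ⟨⟨H, ?_, hH⟩, heq⟩
  rintro rfl
  exact hlt.ne' heq

theorem singleton_one_lt_leftCoset (H : SubgroupPoset G) :
    singleton 1 < leftCoset 1 H.1 H.2.2 := by
  refine lt_of_le_of_ne (singleton_le_iff.mpr (mem_leftCoset_one.mpr H.1.one_mem)) fun h => ?_
  refine H.2.1 (le_bot_iff.mp fun x hx => ?_)
  rw [← mem_leftCoset_one (hH := H.2.2), ← h] at hx
  exact Subgroup.mem_bot.mpr (mem_singleton.mp hx)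

/-- The subgroup underlying a coset above `{1}`. -/
noncomputable def toSubgroup (S : Set.Ioi (singleton (1 : G))) : SubgroupPoset G :=
  (exists_eq_leftCoset_one S).choose

theorem eq_leftCoset_toSubgroup (S : Set.Ioi (singleton (1 : G))) :
    S.1 = leftCoset 1 (toSubgroup S).1 (toSubgroup S).2.2 :=
  (exists_eq_leftCoset_one S).choose_spec

theorem toSubgroup_mono {S T : Set.Ioi (singleton (1 : G))} (h : S ≤ T) :
    toSubgroup S ≤ toSubgroup T := by
  have h' : S.1 ≤ T.1 := h
  rw [eq_leftCoset_toSubgroup S, eq_leftCoset_toSubgroup T] at h'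
  exact leftCoset_one_le_iff.mp h'

theorem toSubgroup_surjective : Function.Surjective (toSubgroup (G := G)) := by
  intro H
  refine ⟨⟨_, singleton_one_lt_leftCoset H⟩, ?_⟩
  have h := eq_leftCoset_toSubgroup ⟨_, singleton_one_lt_leftCoset H⟩
  exact Subtype.ext (le_antisymm
    (leftCoset_one_le_iff (hH := (toSubgroup _).2.2) (hK := H.2.2).mp h.ge)
    (leftCoset_one_le_iff (hH := H.2.2) (hK := (toSubgroup _).2.2).mp h.le))

/-- The component of `L(G)` to which a coset above `{1}` belongs. -/
noncomputable def component (S : Set.Ioi (singleton (1 : G))) :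
    ZerothHomotopy (PosetRealization (SubgroupPoset G)) :=
  GeometricRealization.component (orderComplex (SubgroupPoset G)) (toSubgroup S)

theorem component_eq_of_le (S T : Set.Ioi (singleton (1 : G))) (h : S ≤ T) :
    component S = component T :=
  _root_.component_eq_of_le (toSubgroup_mono h)

theorem component_surjective : Function.Surjective (component (G := G)) :=
  GeometricRealization.component_surjective.comp toSubgroup_surjective

/-- Proper nontrivial subgroups in different components of `L(G)` are connected in `C(G)` outside
`{1}`. -/
theorem linkedAvoiding (S T : Set.Ioi (singleton (1 : G))) (h : component S ≠ component T) :
    LinkedAvoiding (singleton 1) S.1 T.1 := by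
  have hS := eq_leftCoset_toSubgroup S
  have hT := eq_leftCoset_toSubgroup T
  unfold component at h
  set H := toSubgroup S
  set K := toSubgroup T
  rw [hS, hT]
  obtain ⟨a, ha, ha1⟩ := (Subgroup.bot_or_exists_ne_one H.1).resolve_left H.2.1
  obtain ⟨b, hb, hb1⟩ := (Subgroup.bot_or_exists_ne_one K.1).resolve_left K.2.1
  have hab : a * b ≠ 1 := by
    intro hab
    refine h (component_eq_of_mem ha1 ha ?_)
    rw [eq_inv_of_mul_eq_one_left hab]
    exact K.1.inv_mem hb
  obtain ⟨R, hR⟩ := exists_rightCoset H.1 H.2.2 b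
  have link : ∀ {g : G} {U : CosetPoset G}, g ≠ 1 → g ∈ U.1 →
      LinkedAvoiding (singleton 1) (singleton g) U := fun hg hU =>
    LinkedAvoiding.of_le (singleton_le_iff.mpr hU) (singleton_ne_one hg)
  have h1 := link ha1 (mem_leftCoset_one (hH := H.2.2).mpr ha)
  have h2 := link ha1 (mem_leftCoset (g := a) (hH := K.2.2).mpr (by simp))
  have h3 := link hab (mem_leftCoset (g := a) (hH := K.2.2).mpr (by simpa using hb))
  have h4 := link hab ((hR (a * b)).mpr (by simpa using ha))
  have h5 := link hb1 ((hR b).mpr (by simp))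
  have h6 := link hb1 (mem_leftCoset_one (hH := K.2.2).mpr hb)
  exact h1.symm.trans (h2.trans (h3.symm.trans (h4.trans (h5.symm.trans h6))))

/-- The rank of `H₁(C(G))` is at least the number of components of `L(G)` other than a given one. -/
theorem mk_ne_le_rank_homology {G : Type u} [Group G]
    (i₀ : ZerothHomotopy (PosetRealization (SubgroupPoset G))) :
    Cardinal.mk {i // i ≠ i₀} ≤ Module.rank ℤ (PosetHomology.Homology (CosetPoset G) 1) := by
  have := nontrivial_of_component i₀
  exact PosetHomology.mk_ne_le_rank_homology component (isMin_singleton 1) component_eq_of_le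
    component_surjective linkedAvoiding i₀

end CosetPoset

theorem mainTheorem5 (G : Type*) [Group G] :
    (∀ n : ℕ, Cardinal.mk (ZerothHomotopy (PosetRealization (SubgroupPoset G))) = n →
      ((n - 1 : ℕ) : Cardinal) ≤ Module.rank ℤ (PosetHomology.Homology (CosetPoset G) 1)) ∧
    (Infinite (ZerothHomotopy (PosetRealization (SubgroupPoset G))) →
      Cardinal.aleph0 ≤ Module.rank ℤ (PosetHomology.Homology (CosetPoset G) 1)) ∧
    ((¬ ∀ x y : PosetRealization (SubgroupPoset G), Joined x y) →
      ¬ SimplyConnectedSpace (PosetRealization (CosetPoset G))) := by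
  refine ⟨fun n hn => ?_, fun hinf => ?_, fun hdisc => ?_⟩
  · rcases n with _ | n
    · simp
    have hne : Nonempty (ZerothHomotopy (PosetRealization (SubgroupPoset G))) := by
      rw [← Cardinal.mk_ne_zero_iff, hn]
      exact_mod_cast n.succ_ne_zero
    obtain ⟨i₀⟩ := hne
    have : Finite (ZerothHomotopy (PosetRealization (SubgroupPoset G))) :=
      Cardinal.lt_aleph0_iff_finite.mp (hn ▸ Cardinal.natCast_lt_aleph0)
    refine le_trans (le_of_eq ?_) (CosetPoset.mk_ne_le_rank_homology i₀)
    have hcard : Nat.card (ZerothHomotopy (PosetRealization (SubgroupPoset G))) = n + 1 := by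
      simp [Nat.card, hn]
    classical
    have := Fintype.ofFinite (ZerothHomotopy (PosetRealization (SubgroupPoset G)))
    rw [Nat.card_eq_fintype_card] at hcard
    rw [Cardinal.mk_fintype, Fintype.card_subtype_compl, Fintype.card_subtype_eq, hcard]
  · obtain ⟨i₀⟩ : Nonempty (ZerothHomotopy (PosetRealization (SubgroupPoset G))) := inferInstance
    have : Infinite {i // i ≠ i₀} := (Set.finite_singleton i₀).infinite_compl.to_subtype
    exact (Cardinal.aleph0_le_mk _).trans (CosetPoset.mk_ne_le_rank_homology i₀)
  · push Not at hdisc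
    obtain ⟨x, y, hxy⟩ := hdisc
    have := CosetPoset.nontrivial_of_component (Quotient.mk (pathSetoid _) x)
    obtain ⟨S, hS⟩ := CosetPoset.component_surjective (Quotient.mk (pathSetoid _) x)
    obtain ⟨T, hT⟩ := CosetPoset.component_surjective (Quotient.mk (pathSetoid _) y)
    have hST : CosetPoset.component S ≠ CosetPoset.component T := by
      rw [hS, hT]
      exact fun h => hxy (Quotient.exact h)
    exact PosetRealization.not_simplyConnectedSpace CosetPoset.component
      (CosetPoset.isMin_singleton 1) CosetPoset.component_eq_of_le S T hST
      (CosetPoset.linkedAvoiding S T hST)
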